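/- Theorem (Bochner Test). Let $n\ge 1$ and let $s=(s_\alpha)_{\alpha\in\mathbb{N}_0^n}$ be a real sequence such that $s_0=1$ and such that the power series $$f(z):=\sum_{\alpha\in\mathbb{N}_0^n}\frac{i^{|\alpha|}\,s_\alpha}{\alpha!}\,z^\alpha$$ is entire, i.e. converges absolutely for every $z\in\mathbb{C}^n$; here $|\alpha|=\alpha_1+\dots+\alpha_n$, $\alpha!=\alpha_1!\cdots\alpha_n!$ and $z^\alpha=z_1^{\alpha_1}\cdots z_n^{\alpha_n}$. Set $$f_1(z):=\sum_{|\alpha|\ \mathrm{odd}}\frac{i^{|\alpha|}\,s_\alpha}{\alpha!}\,z^\alpha,\qquad f_2(z):=\sum_{|\alpha|\ \mathrm{even}}\frac{i^{|\alpha|}\,s_\alpha}{\alpha!}\,z^\alpha .$$ For a complex square matrix $A$ write $A\succeq 0$ if $A$ is Hermitian and positive semidefinite, and write $A\succeq B$ if $A-B\succeq 0$. Then the following are equivalent: (i) $s$ is a determinate moment sequence, i.e. there is exactly one (non-negative) Borel measure $\mu$ on $\mathbb{R}^n$ such that for all $\alpha\in\mathbb{N}_0^n$ the monomial $x^\alpha$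 is $\mu$-integrable and $s_\alpha=\int_{\mathbb{R}^n}x^\alpha\,\mathrm{d}\mu(x)$. (ii) $\big(f(z_j-z_k)\big)_{j,k=1}^d\succeq 0$ for all $d\in\mathbb{N}$ and all $z_1,\dots,z_d\in\mathbb{R}^n$. (iii) For all $d\in\mathbb{N}$ and all $z_1,\dots,z_d\in\mathbb{R}^n$, $$\big(f_2(z_j-z_k)\big)_{j,k=1}^d\succeq 0\quad\text{and}\quad \big(f_2(z_j-z_k)\big)_{j,k=1}^d\succeq\big(f_1(z_j-z_k)\big)_{j,k=1}^d .$$ -/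

import Mathlib

open MeasureTheory
open scoped ComplexOrder

noncomputable section

namespace BochnerTest

/-- The order `|α| = α₁ + ⋯ + αₙ` of a multi-index. -/
def order {n : ℕ} (α : Fin n → ℕ) : ℕ := ∑ i, α i

/-- The multi-index factorial `α! = α₁! ⋯ αₙ!`. -/
def multiFactorial {n : ℕ} (α : Fin n → ℕ) : ℕ := ∏ i, (α i).factorial

/-- The term `i^|α| s_α z^α / α!` of the power series attached to a real multi-sequence `s`. -/
def term {n : ℕ} (s : (Fin n → ℕ) → ℝ) (z : Fin n → ℂ) (α : Fin n → ℕ) : ℂ :=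
  Complex.I ^ order α * (s α : ℂ) / (multiFactorial α : ℂ) * ∏ i, z i ^ α i

/-- The power series `∑_α i^|α| s_α z^α / α!` is entire: it converges (absolutely, which is the
same as unconditionally) at every point `z ∈ ℂⁿ`. -/
def IsEntire {n : ℕ} (s : (Fin n → ℕ) → ℝ) : Prop :=
  ∀ z : Fin n → ℂ, Summable fun α => term s z α

/-- `f(z) = ∑_α i^|α| s_α z^α / α!`. -/
def f {n : ℕ} (s : (Fin n → ℕ) → ℝ) (z : Fin n → ℂ) : ℂ :=
  ∑' α : Fin n → ℕ, term s z α

/-- The odd part `f₁` of `f`: the sum over all `α` with `|α|` odd. -/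
def f₁ {n : ℕ} (s : (Fin n → ℕ) → ℝ) (z : Fin n → ℂ) : ℂ :=
  ∑' α : {α : Fin n → ℕ // Odd (order α)}, term s z α

/-- The even part `f₂` of `f`: the sum over all `α` with `|α|` even. -/
def f₂ {n : ℕ} (s : (Fin n → ℕ) → ℝ) (z : Fin n → ℂ) : ℂ :=
  ∑' α : {α : Fin n → ℕ // Even (order α)}, term s z α

/-- The (non-negative, Borel) measure `μ` on `ℝⁿ` represents `s`: every monomial `x^α` is
`μ`-integrable and `s_α = ∫ x^α dμ(x)`. (For `α = 0` this forces `μ` to be finite.) -/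
def Represents {n : ℕ} (μ : Measure (EuclideanSpace ℝ (Fin n))) (s : (Fin n → ℕ) → ℝ) : Prop :=
  ∀ α : Fin n → ℕ, Integrable (fun x : EuclideanSpace ℝ (Fin n) => ∏ i, x i ^ α i) μ ∧
    ∫ x : EuclideanSpace ℝ (Fin n), ∏ i, x i ^ α i ∂μ = s α

/-- `s` is a determinate moment sequence: it has exactly one representing measure. -/
def IsDeterminateMomentSequence {n : ℕ} (s : (Fin n → ℕ) → ℝ) : Prop :=
  ∃! μ : Measure (EuclideanSpace ℝ (Fin n)), Represents μ s

/-- A point of `ℝⁿ` seen as a point of `ℂⁿ`. -/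
def toComplex {n : ℕ} (x : EuclideanSpace ℝ (Fin n)) : Fin n → ℂ := fun i => (x i : ℂ)

/-- The `d × d` matrix `(g(z_j - z_k))_{j,k}` for points `z_1, …, z_d ∈ ℝⁿ`. -/
def differenceMatrix {n d : ℕ} (g : (Fin n → ℂ) → ℂ)
    (z : Fin d → EuclideanSpace ℝ (Fin n)) : Matrix (Fin d) (Fin d) ℂ :=
  Matrix.of fun j k => g (toComplex (z j - z k))

end BochnerTest

end

/-! On real points `f` is the only candidate for the characteristic function of a representing
measure, and (ii) says that it is positive definite.

If `μ` represents `s`, entireness makes `exp (∑ |t i * x i|)` integrable, so the exponential series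
integrates termwise and `charFun μ` is `f` (`Represents.charFun_eq`). Characteristic functions are
positive definite and determine finite measures, which gives (ii) and uniqueness.

Conversely, Bochner's theorem (`exists_charFun_eq_of_isPosDefFun`) yields `μ` with `charFun μ = f`.
Finite differences of `f` at scale `h` tend to its coefficients as `h → 0`; under the integral they
are products of factors `exp (i h x i) - 1`. Fatou's lemma gives finite even moments, then dominated
convergence identifies all moments (`represents_of_charFun_eq`).

For (iii), reflecting the points turns `f₂ + f₁` into `f₂ - f₁`. -/

namespace BochnerTest

/-! ### Positive definite functions and kernels -/

section PositiveDefinite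

variable {V : Type*} [NormedAddCommGroup V]

/-- A function `φ` is positive definite if all matrices `(φ (z_j - z_k))` are positive
semidefinite. -/
def IsPosDefFun (φ : V → ℂ) : Prop :=
  ∀ (d : ℕ) (z : Fin d → V), (Matrix.of fun j k => φ (z j - z k)).PosSemidef

lemma isPosDefFun_iff {φ : V → ℂ} : IsPosDefFun φ ↔
    (∀ t, φ (-t) = star (φ t)) ∧ ∀ (d : ℕ) (z : Fin d → V) (c : Fin d → ℂ),
      0 ≤ ∑ j, ∑ k, star (c j) * φ (z j - z k) * c k := by
  have key : ∀ (d : ℕ) (z : Fin d → V) (c : Fin d → ℂ),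
      star c ⬝ᵥ (Matrix.of fun j k => φ (z j - z k)).mulVec c =
        ∑ j, ∑ k, star (c j) * φ (z j - z k) * c k := by
    intro d z c
    simp [dotProduct, Matrix.mulVec, Finset.mul_sum, mul_assoc]
  constructor
  · refine fun h => ⟨fun t => ?_, fun d z c => ?_⟩
    · have := (h 2 ![t, 0]).1.apply 1 0
      simpa using this.symm
    · rw [← key]
      exact (Matrix.posSemidef_iff_dotProduct_mulVec.1 (h d z)).2 c
  · rintro ⟨h1, h2⟩ d z
    refine Matrix.posSemidef_iff_dotProduct_mulVec.2 ⟨?_, fun c => ?_⟩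
    · ext j k
      rw [Matrix.conjTranspose_apply, Matrix.of_apply, Matrix.of_apply, ← h1, neg_sub]
    · rw [key]
      exact h2 d z c

/-- The matrix of the two points `t, 0` has determinant `1 - |φ t|²`. -/
lemma IsPosDefFun.norm_le {φ : V → ℂ} (h : IsPosDefFun φ) (h0 : φ 0 = 1) (t : V) :
    ‖φ t‖ ≤ 1 := by
  have h1 := (h 2 ![t, 0]).det_nonneg
  have h2 := (isPosDefFun_iff.1 h).1 t
  simp only [Matrix.det_fin_two, Matrix.of_apply, Matrix.cons_val_zero, Matrix.cons_val_one,
    sub_self, h0, sub_zero, zero_sub, h2, Complex.star_def, Complex.mul_conj, mul_one] at h1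
  rw [show (1 : ℂ) - (Complex.normSq (φ t) : ℂ) = ((1 - Complex.normSq (φ t) : ℝ) : ℂ) by
    push_cast; rfl, Complex.zero_le_real, Complex.normSq_eq_norm_sq] at h1
  nlinarith [norm_nonneg (φ t)]

/-- The character splits over `z j - z k`, so its factors are absorbed into the coefficients `c`. -/
lemma IsPosDefFun.mul_char [InnerProductSpace ℝ V] {φ : V → ℂ} (h : IsPosDefFun φ) (x : V) :
    IsPosDefFun fun u => φ u * Complex.exp (-(inner ℝ x u : ℝ) * Complex.I) := by
  obtain ⟨h1, h2⟩ := isPosDefFun_iff.1 h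
  refine isPosDefFun_iff.2 ⟨fun t => ?_, fun d z c => ?_⟩
  · simp [h1, ← Complex.exp_conj]
  · convert h2 d z fun k => Complex.exp ((inner ℝ x (z k) : ℝ) * Complex.I) * c k using 2 with j
    refine Finset.sum_congr rfl fun k _ => ?_
    simp only [star_mul', Complex.star_def, ← Complex.exp_conj, map_mul, Complex.conj_ofReal,
      Complex.conj_I, inner_sub_right]
    rw [show (-((inner ℝ x (z j) - inner ℝ x (z k) : ℝ) : ℂ) * Complex.I) =
      ((inner ℝ x (z j) : ℝ) * -Complex.I) + (inner ℝ x (z k) : ℝ) * Complex.I by push_cast; ring,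
      Complex.exp_add]
    ring

end PositiveDefinite

/-- Average the double sum over `N + 1` independent samples of `ν`: each off-diagonal term
contributes the integral `B`, each diagonal term at most `C`. Hence `0 ≤ (N + 1) * (C + N * B)` for
every `N`, which forces `0 ≤ B`. -/
lemma integral_prod_nonneg_of_sum_nonneg {X : Type*} [MeasurableSpace X] (ν : Measure X)
    [IsProbabilityMeasure ν] (K : X → X → ℝ) (hK : Measurable (Function.uncurry K)) (C : ℝ)
    (hC : ∀ s t, |K s t| ≤ C)
    (hpos : ∀ (d : ℕ) (z : Fin d → X), 0 ≤ ∑ j, ∑ k, K (z j) (z k)) :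
    0 ≤ ∫ p, K p.1 p.2 ∂(ν.prod ν) := by
  set B := ∫ p, K p.1 p.2 ∂(ν.prod ν) with hB
  have hmeas : ∀ (N : ℕ) (j k : Fin N), Measurable fun z : Fin N → X => K (z j) (z k) :=
    fun N j k => hK.comp (g := Function.uncurry K)
      (f := fun z : Fin N → X => (z j, z k))
      ((measurable_pi_apply j).prodMk (measurable_pi_apply k))
  have hint : ∀ (N : ℕ) (j k : Fin N),
      Integrable (fun z : Fin N → X => K (z j) (z k)) (Measure.pi fun _ => ν) :=
    fun N j k => Integrable.of_bound (hmeas N j k).aestronglyMeasurable C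
      (.of_forall fun z => hC _ _)
  have hoff : ∀ (N : ℕ) (j k : Fin N), j ≠ k →
      ∫ z : Fin N → X, K (z j) (z k) ∂(Measure.pi fun _ => ν) = B := by
    intro N j k hjk
    have hind := (ProbabilityTheory.iIndepFun_pi (μ := fun _ : Fin N => ν)
      (X := fun _ x => x) (fun _ => aemeasurable_id)).indepFun hjk
    rw [ProbabilityTheory.indepFun_iff_map_prod_eq_prod_map_map
      (measurable_pi_apply j).aemeasurable (measurable_pi_apply k).aemeasurable] at hind
    have e : ∀ i : Fin N, Measure.map (fun ω : Fin N → X => ω i) (Measure.pi fun _ => ν) = ν :=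
      fun i => (measurePreserving_eval (fun _ : Fin N => ν) i).map_eq
    rw [e, e] at hind
    rw [hB, ← hind, integral_map]
    · exact ((measurable_pi_apply j).prodMk (measurable_pi_apply k)).aemeasurable
    · exact hK.aestronglyMeasurable
  have hN : ∀ N : ℕ, 0 ≤ C + N * B := by
    intro N
    have h1 : 0 ≤ ∫ z : Fin (N + 1) → X, ∑ j, ∑ k, K (z j) (z k) ∂(Measure.pi fun _ => ν) :=
      integral_nonneg fun z => hpos _ z
    rw [integral_finsetSum _ fun j _ => integrable_finsetSum _ fun k _ => hint _ j k] at h1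
    have h2 : ∀ j : Fin (N + 1),
        ∫ z : Fin (N + 1) → X, ∑ k, K (z j) (z k) ∂(Measure.pi fun _ => ν) ≤ C + N * B := by
      intro j
      rw [integral_finsetSum _ fun k _ => hint _ j k, ← Finset.add_sum_erase _ _ (Finset.mem_univ j)]
      refine add_le_add ?_ (le_of_eq ?_)
      · refine (integral_mono (hint _ j j) (integrable_const C)
          fun z => (le_abs_self _).trans (hC _ _)).trans ?_
        simp
      · rw [Finset.sum_congr rfl fun k hk => hoff _ j k (Finset.ne_of_mem_erase hk).symm]
        simp
    have h3 := h1.trans (Finset.sum_le_sum fun j _ => h2 j)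
    rw [Finset.sum_const, Finset.card_univ, Fintype.card_fin, nsmul_eq_mul] at h3
    exact nonneg_of_mul_nonneg_right h3 (by positivity)
  by_contra! hneg
  obtain ⟨N, hN'⟩ := exists_nat_gt (C / (-B))
  rw [div_lt_iff₀ (by linarith)] at hN'
  linarith [hN N]

/-! ### Gaussian-damped Fourier transforms -/

section Gaussian

variable {V : Type*} [NormedAddCommGroup V] [InnerProductSpace ℝ V] [FiniteDimensional ℝ V]
  [MeasurableSpace V] [BorelSpace V]

lemma integrable_exp_neg_mul_sq_norm {a : ℝ} (ha : 0 < a) :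
    Integrable fun v : V => Real.exp (-a * ‖v‖ ^ 2) := by
  have h := (GaussianFourier.integrable_cexp_neg_mul_sq_norm_add (V := V) (b := a)
    (by simpa using ha) 0 0).norm
  refine h.congr (.of_forall fun v => ?_)
  simp only [zero_mul, add_zero, Complex.norm_exp]
  norm_cast

lemma integral_exp_neg_mul_sq_norm_pos {a : ℝ} (ha : 0 < a) :
    0 < ∫ v : V, Real.exp (-a * ‖v‖ ^ 2) := by
  rw [GaussianFourier.integral_rexp_neg_mul_sq_norm ha]
  exact Real.rpow_pos_of_pos (by positivity) _

lemma integrable_mul_gaussian {φ : V → ℂ} (hc : Continuous φ) (hb : ∀ t, ‖φ t‖ ≤ 1) {a : ℝ}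
    (ha : 0 < a) : Integrable fun v : V => φ v * (Real.exp (-a * ‖v‖ ^ 2) : ℝ) :=
  (integrable_exp_neg_mul_sq_norm ha).ofReal.bdd_mul hc.aestronglyMeasurable (.of_forall hb)

/-- For independent Gaussian `X, Y` the expectation of `Re φ (Y - X)` is nonnegative, and `Y - X` is
again Gaussian. Densities proportional to `exp (-2a‖v‖²)` give the difference a density proportional
to `exp (-a‖u‖²)`. -/
lemma integral_mul_gaussian_re_nonneg {φ : V → ℂ} (h : IsPosDefFun φ) (hc : Continuous φ)
    (hb : ∀ t, ‖φ t‖ ≤ 1) {a : ℝ} (ha : 0 < a) :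
    0 ≤ ∫ v, (φ v).re * Real.exp (-a * ‖v‖ ^ 2) := by
  set Z := ∫ v : V, Real.exp (-(2 * a) * ‖v‖ ^ 2) with hZ
  have hZpos : 0 < Z := integral_exp_neg_mul_sq_norm_pos (by positivity)
  have hgi := integrable_exp_neg_mul_sq_norm (V := V) (a := 2 * a) (by positivity)
  set g : V → ℝ := fun v => Real.exp (-(2 * a) * ‖v‖ ^ 2) / Z with hg
  have hgm : Measurable g := by fun_prop
  have hg0 : ∀ v, 0 ≤ g v := fun v => by positivity
  let ν : Measure V := volume.withDensity fun v => ENNReal.ofReal (g v)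
  have hν : IsProbabilityMeasure ν := by
    constructor
    rw [withDensity_apply _ MeasurableSet.univ, Measure.restrict_univ,
      ← ofReal_integral_eq_lintegral_ofReal (hgi.div_const Z) (.of_forall hg0),
      integral_div, ← hZ, div_self hZpos.ne', ENNReal.ofReal_one]
  have hKm : Measurable (Function.uncurry fun s t : V => (φ (t - s)).re) := by
    have : Continuous (Function.uncurry fun s t : V => (φ (t - s)).re) :=
      Complex.continuous_re.comp (hc.comp (continuous_snd.sub continuous_fst))
    exact this.measurable
  have key := integral_prod_nonneg_of_sum_nonneg ν (fun s t => (φ (t - s)).re) hKm 1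
    (fun s t => (Complex.abs_re_le_norm _).trans (hb _)) fun d z => by
      have := (Complex.le_def.1 ((isPosDefFun_iff.1 h).2 d z 1)).1
      rw [Finset.sum_comm]
      simpa using this
  have hofm : Measurable fun v => ENNReal.ofReal (g v) := hgm.ennreal_ofReal
  rw [prod_withDensity hofm hofm, integral_withDensity_eq_integral_toReal_smul
    (by fun_prop) (.of_forall fun p => by finiteness)] at key
  set F : V × V → ℝ := fun p =>
    (ENNReal.ofReal (g p.1) * ENNReal.ofReal (g p.2)).toReal • (φ (p.2 - p.1)).re with hF
  have hFe : ∀ p, F p = g p.1 * g p.2 * (φ (p.2 - p.1)).re := by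
    intro p
    simp only [hF, ENNReal.toReal_mul, ENNReal.toReal_ofReal (hg0 _), smul_eq_mul]
  have hFi : Integrable F (volume.prod volume) := by
    refine (((hgi.div_const Z).mul_prod (hgi.div_const Z)).mul_bdd (c := 1)
      (g := fun p : V × V => (φ (p.2 - p.1)).re) ?_ ?_).congr (.of_forall fun p => (hFe p).symm)
    · exact (hKm : Measurable fun p : V × V => (φ (p.2 - p.1)).re).aestronglyMeasurable
    · exact .of_forall fun p => (Complex.abs_re_le_norm _).trans (hb _)
  -- A shear makes the difference of the two points the first coordinate.
  have mp := measurePreserving_prod_add_swap (volume : Measure V) volume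
  have hmap := integral_map (μ := (volume : Measure V).prod volume) mp.measurable.aemeasurable
    (f := F) (by rw [mp.map_eq]; exact hFi.aestronglyMeasurable)
  rw [mp.map_eq] at hmap
  rw [hmap, integral_prod (fun z : V × V => F (z.2, z.2 + z.1)) (mp.integrable_comp_of_integrable hFi)] at key
  have inner : ∀ u : V, ∫ y, F (y, y + u) = (φ u).re * Real.exp (-a * ‖u‖ ^ 2) *
      ((∫ y : V, Real.exp (-(4 * a) * ‖y‖ ^ 2)) / Z ^ 2) := by
    intro u
    -- Shifting by `u / 2` completes the square: `‖y‖² + ‖y + u‖² = 2‖y + u/2‖² + ‖u‖²/2`.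
    rw [← integral_add_right_eq_self (μ := (volume : Measure V))
      (fun y => Real.exp (-(4 * a) * ‖y‖ ^ 2)) ((1 / 2 : ℝ) • u), ← integral_div,
      ← integral_const_mul]
    refine integral_congr_ae (.of_forall fun y => ?_)
    simp only [hFe, add_sub_cancel_left, hg]
    rw [show Real.exp (-(2 * a) * ‖y‖ ^ 2) / Z * (Real.exp (-(2 * a) * ‖y + u‖ ^ 2) / Z) *
      (φ u).re = (φ u).re * (Real.exp (-(2 * a) * ‖y‖ ^ 2) * Real.exp (-(2 * a) * ‖y + u‖ ^ 2)) /
        Z ^ 2 by ring, mul_div_assoc', mul_assoc ((φ u).re), ← Real.exp_add, ← Real.exp_add]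
    congr 3
    rw [norm_add_sq_real, norm_add_sq_real, inner_smul_right, norm_smul]
    norm_num
    ring
  simp only [inner] at key
  rw [integral_mul_const] at key
  have hpos : 0 < (∫ y : V, Real.exp (-(4 * a) * ‖y‖ ^ 2)) / Z ^ 2 :=
    div_pos (integral_exp_neg_mul_sq_norm_pos (by positivity)) (by positivity)
  exact nonneg_of_mul_nonneg_left key hpos

/-- The Fourier transform of `φ` damped by a Gaussian. -/
noncomputable def dampedFourier (φ : V → ℂ) (a : ℝ) (x : V) : ℂ :=
  ∫ u, φ u * Complex.exp (-(inner ℝ x u : ℝ) * Complex.I) * (Real.exp (-a * ‖u‖ ^ 2) : ℝ)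

lemma norm_mul_char (z : ℂ) (r : ℝ) : ‖z * Complex.exp (-(r : ℂ) * Complex.I)‖ = ‖z‖ := by
  rw [norm_mul, ← Complex.ofReal_neg, Complex.norm_exp_ofReal_mul_I, mul_one]

/-- Nonnegativity is the preceding integral inequality for `φ` times a character; realness follows
from `φ (-u) = star (φ u)` and `u ↦ -u`. -/
lemma dampedFourier_eq {φ : V → ℂ} (h : IsPosDefFun φ) (hc : Continuous φ)
    (hb : ∀ t, ‖φ t‖ ≤ 1) {a : ℝ} (ha : 0 < a) (x : V) :
    0 ≤ (dampedFourier φ a x).re ∧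
      ((dampedFourier φ a x).re : ℂ) = dampedFourier φ a x := by
  have h' := h.mul_char x
  have hc' : Continuous fun u => φ u * Complex.exp (-(inner ℝ x u : ℝ) * Complex.I) := by fun_prop
  have hb' : ∀ u, ‖φ u * Complex.exp (-(inner ℝ x u : ℝ) * Complex.I)‖ ≤ 1 := fun u => by
    rw [norm_mul_char]; exact hb u
  have hi := integrable_mul_gaussian hc' hb' ha
  constructor
  · have := integral_mul_gaussian_re_nonneg h' hc' hb' ha
    convert this using 1
    rw [dampedFourier, ← RCLike.re_eq_complex_re, ← integral_re hi]
    refine integral_congr_ae (.of_forall fun u => ?_)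
    simp only [RCLike.re_eq_complex_re, Complex.re_mul_ofReal]
  · rw [← Complex.conj_eq_iff_re, dampedFourier, ← integral_conj,
      ← integral_neg_eq_self (μ := (volume : Measure V)) fun u => φ u *
        Complex.exp (-(inner ℝ x u : ℝ) * Complex.I) * (Real.exp (-a * ‖u‖ ^ 2) : ℝ)]
    refine integral_congr_ae (.of_forall fun u => ?_)
    have := (isPosDefFun_iff.1 h').1 u
    simp only [norm_neg, map_mul, Complex.conj_ofReal] at this ⊢
    rw [this, Complex.star_def, map_mul]

lemma measurable_dampedFourier {φ : V → ℂ} (hc : Continuous φ) (a : ℝ) :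
    Measurable (dampedFourier φ a) := by
  have : Continuous (Function.uncurry fun x u : V => φ u *
      Complex.exp (-(inner ℝ x u : ℝ) * Complex.I) * (Real.exp (-a * ‖u‖ ^ 2) : ℝ)) := by
    simp only [Function.uncurry_def]
    fun_prop
  exact (this.stronglyMeasurable.integral_prod_right).measurable

lemma norm_dampedFourier_le {φ : V → ℂ} (hb : ∀ t, ‖φ t‖ ≤ 1) {a : ℝ} (ha : 0 < a) (x : V) :
    ‖dampedFourier φ a x‖ ≤ ∫ u : V, Real.exp (-a * ‖u‖ ^ 2) := by
  refine norm_integral_le_of_norm_le (integrable_exp_neg_mul_sq_norm ha) (.of_forall fun u => ?_)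
  rw [norm_mul, norm_mul_char, Complex.norm_real, Real.norm_of_nonneg (Real.exp_pos _).le]
  exact mul_le_of_le_one_left (Real.exp_pos _).le (hb u)

/-- The average of `φ` against a Gaussian around `t`, damped by a Gaussian around `0`. -/
noncomputable def gaussianAverage (φ : V → ℂ) (a r : ℝ) (t : V) : ℂ :=
  ∫ v, φ (t + r • v) * (Real.exp (-a * ‖t + r • v‖ ^ 2) : ℝ) * (Real.exp (-‖v‖ ^ 2) : ℝ)

/-- Regularized Fourier inversion: the extra Gaussian in `x` justifies Fubini, and its own transform
is a Gaussian of width `r` around `t`. The exponent `r² / 4` makes that kernel exactly `exp (-(‖t -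
u‖ / r)²)`; then `u = t + r • v`. -/
lemma integral_dampedFourier_mul {φ : V → ℂ} (hc : Continuous φ)
    (hb : ∀ t, ‖φ t‖ ≤ 1) {a r : ℝ} (ha : 0 < a) (hr : 0 < r) (t : V) :
    ∫ x, dampedFourier φ a x * (Real.exp (-(r ^ 2 / 4) * ‖x‖ ^ 2) : ℝ) *
        Complex.exp ((inner ℝ x t : ℝ) * Complex.I) =
      ((Real.pi / (r ^ 2 / 4 : ℝ) : ℂ) ^ (Module.finrank ℝ V / 2 : ℂ) *
        (r ^ Module.finrank ℝ V : ℝ)) * gaussianAverage φ a r t := by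
  have hb4 : 0 < r ^ 2 / 4 := by positivity
  have e1 : ∀ x : V, dampedFourier φ a x * (Real.exp (-(r ^ 2 / 4) * ‖x‖ ^ 2) : ℝ) *
        Complex.exp ((inner ℝ x t : ℝ) * Complex.I) =
      ∫ u, φ u * (Real.exp (-a * ‖u‖ ^ 2) : ℝ) *
        Complex.exp (-((r ^ 2 / 4 : ℝ) : ℂ) * ‖x‖ ^ 2 + Complex.I * (inner ℝ (t - u) x : ℝ)) := by
    intro x
    rw [dampedFourier, ← integral_mul_const, ← integral_mul_const]
    refine integral_congr_ae (.of_forall fun u => ?_)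
    have : Complex.exp (-((r ^ 2 / 4 : ℝ) : ℂ) * ‖x‖ ^ 2 + Complex.I * (inner ℝ (t - u) x : ℝ)) =
        Complex.exp (-(inner ℝ x u : ℝ) * Complex.I) *
          (Real.exp (-(r ^ 2 / 4) * ‖x‖ ^ 2) : ℝ) * Complex.exp ((inner ℝ x t : ℝ) * Complex.I) := by
      rw [Complex.ofReal_exp, ← Complex.exp_add, ← Complex.exp_add, inner_sub_left,
        real_inner_comm t, real_inner_comm u]
      congr 1
      push_cast
      ring
    simp only [this]
    ring
  simp only [e1]
  rw [integral_integral_swap]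
  · have e2 : ∀ u : V, ∫ x : V, φ u * (Real.exp (-a * ‖u‖ ^ 2) : ℝ) *
        Complex.exp (-((r ^ 2 / 4 : ℝ) : ℂ) * ‖x‖ ^ 2 + Complex.I * (inner ℝ (t - u) x : ℝ)) =
        (Real.pi / (r ^ 2 / 4 : ℝ) : ℂ) ^ (Module.finrank ℝ V / 2 : ℂ) *
        (φ u * (Real.exp (-a * ‖u‖ ^ 2) : ℝ) * (Real.exp (-(‖t - u‖ / r) ^ 2) : ℝ)) := by
      intro u
      rw [integral_const_mul, GaussianFourier.integral_cexp_neg_mul_sq_norm_add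
        (by rw [Complex.ofReal_re]; exact hb4)]
      have : Complex.exp (Complex.I ^ 2 * ‖t - u‖ ^ 2 / (4 * ((r ^ 2 / 4 : ℝ) : ℂ))) =
          (Real.exp (-(‖t - u‖ / r) ^ 2) : ℝ) := by
        rw [Complex.ofReal_exp]
        congr 1
        push_cast
        rw [Complex.I_sq]
        ring
      rw [this]
      ring
    simp only [e2]
    rw [integral_const_mul, mul_assoc, gaussianAverage, ← integral_add_left_eq_self _ t]
    congr 1
    have := Measure.integral_comp_smul (volume : Measure V) (fun w => φ (t + w) *
      (Real.exp (-a * ‖t + w‖ ^ 2) : ℝ) * (Real.exp (-(‖t - (t + w)‖ / r) ^ 2) : ℝ)) r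
    have hrn : (0 : ℝ) < r ^ Module.finrank ℝ V := by positivity
    rw [abs_of_pos (by positivity)] at this
    simp only [sub_add_cancel_left, norm_neg, norm_smul, Real.norm_of_nonneg hr.le,
      mul_div_cancel_left₀ _ hr.ne'] at this
    rw [this, Complex.real_smul, ← mul_assoc, ← Complex.ofReal_mul, mul_inv_cancel₀ hrn.ne',
      Complex.ofReal_one, one_mul]
    simp only [sub_add_cancel_left, norm_neg]
  · have hmeas : Continuous (Function.uncurry fun x u : V => φ u * (Real.exp (-a * ‖u‖ ^ 2) : ℝ) *
        Complex.exp (-((r ^ 2 / 4 : ℝ) : ℂ) * ‖x‖ ^ 2 + Complex.I * (inner ℝ (t - u) x : ℝ))) := by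
      simp only [Function.uncurry_def]
      fun_prop
    refine ((integrable_exp_neg_mul_sq_norm (V := V) hb4).mul_prod
      (integrable_exp_neg_mul_sq_norm (V := V) ha)).mono' hmeas.aestronglyMeasurable
      (.of_forall fun p => ?_)
    simp only [Function.uncurry_def, norm_mul, Complex.norm_real, Complex.norm_exp,
      Real.norm_of_nonneg (Real.exp_pos _).le]
    have : (-((r ^ 2 / 4 : ℝ) : ℂ) * ‖p.1‖ ^ 2 + Complex.I * (inner ℝ (t - p.2) p.1 : ℝ)).re =
        -(r ^ 2 / 4) * ‖p.1‖ ^ 2 := by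
      rw [Complex.add_re, Complex.I_mul_re, Complex.ofReal_im, neg_zero, add_zero]
      norm_cast
    rw [this, mul_comm (Real.exp (-(r ^ 2 / 4) * _))]
    gcongr
    exact mul_le_of_le_one_left (Real.exp_pos _).le (hb _)

end Gaussian
-- Bochner's theorem
section Bochner

open Filter Topology

variable {V : Type*} [NormedAddCommGroup V] [InnerProductSpace ℝ V] [FiniteDimensional ℝ V]
  [MeasurableSpace V] [BorelSpace V]

/-- The nonnegative damped transform, times a Gaussian, serves as a density. -/
lemma exists_finite_measure_charFun {φ : V → ℂ} (h : IsPosDefFun φ) (hc : Continuous φ)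
    (hb : ∀ t, ‖φ t‖ ≤ 1) {a r : ℝ} (ha : 0 < a) (hr : 0 < r) :
    ∃ μ : Measure V, IsFiniteMeasure μ ∧ ∃ C : ℂ, C ≠ 0 ∧
      ∀ t, charFun μ t = C * gaussianAverage φ a r t := by
  have hb4 : 0 < r ^ 2 / 4 := by positivity
  set D : V → ℝ := fun x => (dampedFourier φ a x).re * Real.exp (-(r ^ 2 / 4) * ‖x‖ ^ 2) with hD
  have hD0 : ∀ x, 0 ≤ D x := fun x =>
    mul_nonneg (dampedFourier_eq h hc hb ha x).1 (Real.exp_pos _).le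
  have hDm : Measurable D := by
    have := measurable_dampedFourier hc a
    fun_prop
  have hDi : Integrable D := by
    refine (integrable_exp_neg_mul_sq_norm (V := V) hb4).bdd_mul
      (c := ∫ u : V, Real.exp (-a * ‖u‖ ^ 2))
      (Complex.measurable_re.comp (measurable_dampedFourier hc a)).aestronglyMeasurable
      (.of_forall fun x => (Complex.abs_re_le_norm _).trans (norm_dampedFourier_le hb ha x))
  refine ⟨volume.withDensity fun x => ENNReal.ofReal (D x),
    isFiniteMeasure_withDensity_ofReal hDi.2, _, ?_,
    fun t => (Eq.trans ?_ (integral_dampedFourier_mul hc hb ha hr t))⟩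
  · refine mul_ne_zero ?_ (by exact_mod_cast (pow_pos hr _).ne')
    rw [Complex.cpow_ne_zero_iff]
    left
    exact div_ne_zero (by exact_mod_cast Real.pi_ne_zero) (by exact_mod_cast hb4.ne')
  · rw [charFun_apply, integral_withDensity_eq_integral_toReal_smul (by fun_prop)
      (.of_forall fun p => by finiteness)]
    refine integral_congr_ae (.of_forall fun x => ?_)
    simp only [ENNReal.toReal_ofReal (hD0 x), Complex.real_smul]
    rw [← (dampedFourier_eq h hc hb ha x).2, ← Complex.ofReal_mul]

lemma exists_probability_measure_charFun {φ : V → ℂ} (h : IsPosDefFun φ) (hc : Continuous φ)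
    (hb : ∀ t, ‖φ t‖ ≤ 1) {a r : ℝ} (ha : 0 < a) (hr : 0 < r)
    (h0 : gaussianAverage φ a r 0 ≠ 0) :
    ∃ μ : ProbabilityMeasure V,
      ∀ t, charFun (μ : Measure V) t = gaussianAverage φ a r t / gaussianAverage φ a r 0 := by
  obtain ⟨μ, hμ, C, hC, hμC⟩ := exists_finite_measure_charFun h hc hb ha hr
  have hmass : ((μ.real Set.univ : ℝ) : ℂ) = C * gaussianAverage φ a r 0 := by
    rw [← hμC, charFun_zero]
  have hne : μ.real Set.univ ≠ 0 := by
    have := mul_ne_zero hC h0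
    rw [← hmass] at this
    exact_mod_cast this
  have hμ0 : NeZero μ := ⟨by rintro rfl; simp at hne⟩
  refine ⟨⟨(μ Set.univ)⁻¹ • μ, inferInstance⟩, fun t => ?_⟩
  rw [ProbabilityMeasure.coe_mk, charFun_apply, integral_smul_measure, ← charFun_apply, hμC,
    ENNReal.toReal_inv, ← measureReal_def, Complex.real_smul, Complex.ofReal_inv, hmass]
  field_simp

lemma tendsto_gaussianAverage {φ : V → ℂ} (hc : Continuous φ) (hb : ∀ t, ‖φ t‖ ≤ 1) (t : V) :
    Tendsto (fun m : ℕ => gaussianAverage φ (1 / ((m : ℝ) + 1)) (1 / ((m : ℝ) + 1)) t) atTop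
      (𝓝 (φ t * ((∫ v : V, Real.exp (-1 * ‖v‖ ^ 2) : ℝ) : ℂ))) := by
  rw [← integral_complex_ofReal, ← integral_const_mul]
  refine tendsto_integral_of_dominated_convergence (fun v : V => Real.exp (-1 * ‖v‖ ^ 2)) ?_
    (integrable_exp_neg_mul_sq_norm one_pos) ?_ ?_
  · intro m
    exact Continuous.aestronglyMeasurable (by fun_prop)
  · refine fun m => .of_forall fun v => ?_
    simp only [norm_mul, Complex.norm_real, Real.norm_of_nonneg (Real.exp_pos _).le]
    rw [neg_one_mul]
    refine mul_le_of_le_one_left (Real.exp_pos _).le (mul_le_one₀ (hb _) (Real.exp_pos _).le ?_)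
    rw [Real.exp_le_one_iff, neg_mul, Left.neg_nonpos_iff]
    positivity
  · refine .of_forall fun v => ?_
    have hG : Continuous fun e : ℝ => φ (t + e • v) * (Real.exp (-e * ‖t + e • v‖ ^ 2) : ℝ) *
      (Real.exp (-‖v‖ ^ 2) : ℝ) := by fun_prop
    have := (hG.tendsto 0).comp (tendsto_one_div_add_atTop_nhds_zero_nat (𝕜 := ℝ))
    simpa [Function.comp_def] using this

/-- **Bochner's theorem**: a normalized continuous positive definite function is the
characteristic function of a probability measure. -/
theorem exists_charFun_eq_of_isPosDefFun {φ : V → ℂ} (h : IsPosDefFun φ) (hc : Continuous φ)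
    (h0 : φ 0 = 1) : ∃ μ : Measure V, IsProbabilityMeasure μ ∧ ∀ t, charFun μ t = φ t := by
  have hb := h.norm_le h0
  set e : ℕ → ℝ := fun m => 1 / ((m : ℝ) + 1) with he
  have hepos : ∀ m, 0 < e m := fun m => by positivity
  set I : ℂ := ((∫ v : V, Real.exp (-1 * ‖v‖ ^ 2) : ℝ) : ℂ) with hI
  have hIne : I ≠ 0 :=
    Complex.ofReal_ne_zero.2 (integral_exp_neg_mul_sq_norm_pos (V := V) one_pos).ne'
  have hlim : ∀ t, Tendsto (fun m => gaussianAverage φ (e m) (e m) t) atTop (𝓝 (φ t * I)) :=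
    tendsto_gaussianAverage hc hb
  have hlim0 : Tendsto (fun m => gaussianAverage φ (e m) (e m) 0) atTop (𝓝 I) := by
    simpa [h0] using hlim 0
  -- Normalization needs a nonzero total mass, which holds from some index on.
  obtain ⟨N, hN⟩ := eventually_atTop.1 (hlim0.eventually_ne hIne)
  choose μ hμ using fun m : ℕ => exists_probability_measure_charFun h hc hb (hepos (m + N))
    (hepos (m + N)) (hN (m + N) (Nat.le_add_left N m))
  have hμlim : ∀ t, Tendsto (fun m => charFun (μ m : Measure V) t) atTop (𝓝 (φ t)) := by
    intro t
    simp only [hμ]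
    have := (((hlim t).div hlim0 hIne).comp (tendsto_add_atTop_nat N))
    simpa [Function.comp_def, hIne] using this
  -- As in Lévy's theorem, continuity of the limit at `0` gives tightness; Prokhorov then gives a
  -- weak limit along an ultrafilter, whose characteristic function must be `φ`.
  have htight := isTightMeasureSet_of_tendsto_charFun hc.continuousAt hμlim
  have hcomp := isCompact_closure_of_isTightMeasureSet (S := Set.range μ) (by
    convert htight using 1
    ext x
    simp)
  obtain ⟨ν, -, hν⟩ := isCompact_iff_ultrafilter_le_nhds.1 hcomp
    ((hyperfilter ℕ : Ultrafilter ℕ).map μ) (by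
      rw [le_principal_iff]
      exact mem_of_superset (Filter.mem_map.2 (univ_mem' fun m => Set.mem_range_self m))
        subset_closure)
  refine ⟨ν, inferInstance, fun t => ?_⟩
  have h1 : Tendsto μ (hyperfilter ℕ : Filter ℕ) (𝓝 ν) := hν
  rw [ProbabilityMeasure.tendsto_iff_forall_integral_rclike_tendsto ℂ] at h1
  have h2 := h1 (BoundedContinuousFunction.innerProbChar t)
  simp only [← charFun_eq_integral_innerProbChar] at h2
  exact tendsto_nhds_unique h2 ((hμlim t).mono_left Nat.hyperfilter_le_atTop)

end Bochner

/-! ### The power series and multivariate exponential series -/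

open Filter Topology

lemma norm_term {n : ℕ} (s : (Fin n → ℕ) → ℝ) (z : Fin n → ℂ) (α : Fin n → ℕ) :
    ‖term s z α‖ = |s α| / multiFactorial α * ∏ i, ‖z i‖ ^ α i := by
  simp [term]

lemma term_real_smul {n : ℕ} (s : (Fin n → ℕ) → ℝ) (h : ℝ) (z : Fin n → ℂ) (α : Fin n → ℕ) :
    term s (fun i => h * z i) α = (h : ℂ) ^ order α * term s z α := by
  simp only [term, order, mul_pow, Finset.prod_mul_distrib, Finset.prod_pow_eq_pow_sum]
  ring

lemma continuous_f_toComplex {n : ℕ} {s : (Fin n → ℕ) → ℝ} (hs : IsEntire s) :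
    Continuous fun x : EuclideanSpace ℝ (Fin n) => f s (toComplex x) := by
  rw [continuous_iff_continuousAt]
  intro x₀
  have hcont : ContinuousOn (fun x : EuclideanSpace ℝ (Fin n) => f s (toComplex x))
      (Metric.ball x₀ 1) := by
    -- Weierstrass M-test on the unit ball around `x₀`, where every coordinate is at most `‖x₀‖ + 1`
    -- in absolute value.
    refine continuousOn_tsum (u := fun α => ‖term s (fun _ => ((‖x₀‖ + 1 : ℝ) : ℂ)) α‖)
      (fun α => ?_) (hs _).norm fun α x hx => ?_
    · refine Continuous.continuousOn ?_
      simp only [term, toComplex]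
      fun_prop
    · rw [norm_term, norm_term]
      gcongr with i
      have h0 : (0 : ℝ) ≤ ‖x₀‖ + 1 := by positivity
      simp only [toComplex, Complex.norm_real, Real.norm_of_nonneg h0]
      refine (PiLp.norm_apply_le x i).trans ?_
      have := norm_sub_norm_le x x₀
      rw [mem_ball_iff_norm] at hx
      linarith
  exact hcont.continuousAt (Metric.ball_mem_nhds x₀ one_pos)

/-- Absolutely convergent series can be multiplied along a finite product. -/
lemma hasSum_prod_pi {R : Type*} [NormedCommRing R] [CompleteSpace R] {n : ℕ}
    (g : Fin n → ℕ → R) (S : Fin n → R) (hg : ∀ i, HasSum (g i) (S i))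
    (hn : ∀ i, Summable fun k => ‖g i k‖) :
    HasSum (fun α : Fin n → ℕ => ∏ i, g i (α i)) (∏ i, S i) ∧
      Summable fun α : Fin n → ℕ => ‖∏ i, g i (α i)‖ := by
  induction n with
  | zero => exact ⟨by simp, (hasSum_fintype _).summable⟩
  | succ n ih =>
    obtain ⟨h1, h2⟩ := ih (fun i => g i.succ) (fun i => S i.succ) (fun i => hg i.succ)
      fun i => hn i.succ
    have h3 := (hn 0).mul_norm h2
    have h4 := (hg 0).mul h1 h3.of_norm
    have e : ∀ p : ℕ × (Fin n → ℕ), (∏ i, g i ((Fin.consEquiv fun _ => ℕ) p i)) =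
        g 0 p.1 * ∏ i, g i.succ (p.2 i) := fun p => by
      simp [Fin.prod_univ_succ, Fin.consEquiv]
    rw [Fin.prod_univ_succ, ← (Fin.consEquiv fun _ => ℕ).hasSum_iff,
      ← (Fin.consEquiv fun _ => ℕ).summable_iff]
    simp only [Function.comp_def, e]
    exact ⟨h4, h3⟩

lemma hasSum_prod_pow_div_factorial {n : ℕ} (y : Fin n → ℝ) :
    HasSum (fun α : Fin n → ℕ => (∏ i, y i ^ α i) / (multiFactorial α : ℝ))
      (Real.exp (∑ i, y i)) := by
  rw [Real.exp_sum]
  simpa only [multiFactorial, Finset.prod_div_distrib, Nat.cast_prod, Pi.mul_apply,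
    Pi.ofNat_apply] using (hasSum_prod_pi (fun i k => y i ^ k / (k.factorial : ℝ)) _
    (fun i => Real.exp_eq_exp_ℝ ▸ NormedSpace.expSeries_div_hasSum_exp (y i))
    fun i => NormedSpace.norm_expSeries_div_summable (y i)).1

lemma hasSum_prod_pow_div_factorial_complex {n : ℕ} (y : Fin n → ℂ) :
    HasSum (fun α : Fin n → ℕ => (∏ i, y i ^ α i) / (multiFactorial α : ℂ))
      (Complex.exp (∑ i, y i)) := by
  rw [Complex.exp_sum]
  simpa only [multiFactorial, Finset.prod_div_distrib, Nat.cast_prod, Pi.mul_apply,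
    Pi.ofNat_apply] using (hasSum_prod_pi (fun i k => y i ^ k / (k.factorial : ℂ)) _
    (fun i => Complex.exp_eq_exp_ℂ ▸ NormedSpace.expSeries_div_hasSum_exp (y i))
    fun i => NormedSpace.norm_expSeries_div_summable (y i)).1

lemma hasSum_prod_cosh {n : ℕ} (y : Fin n → ℝ) :
    HasSum (fun α : Fin n → ℕ => (∏ i, y i ^ (2 * α) i) / (multiFactorial (2 * α) : ℝ))
      (∏ i, Real.cosh (y i)) := by
  simpa only [multiFactorial, Finset.prod_div_distrib, Nat.cast_prod, Pi.mul_apply,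
    Pi.ofNat_apply] using (hasSum_prod_pi (fun i k => y i ^ (2 * k) / ((2 * k).factorial : ℝ)) _
    (fun i => Real.hasSum_cosh (y i))
    fun i => (Real.hasSum_cosh (y i)).summable.norm).1

/-! ### From moments to the characteristic function -/

lemma Represents.isFiniteMeasure {n : ℕ} {μ : Measure (EuclideanSpace ℝ (Fin n))}
    {s : (Fin n → ℕ) → ℝ} (h : Represents μ s) : IsFiniteMeasure μ := by
  have := (h 0).1
  simp only [Pi.zero_apply, pow_zero, Finset.prod_const_one] at this
  exact (integrable_const_iff_isFiniteMeasure one_ne_zero).1 this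

/-- Absolute moments are not given, so the product of `cosh` is used: its series has only even,
hence nonnegative, monomials. Tonelli bounds its integral by a subseries of the absolutely
convergent series at `t`, and `exp |y| ≤ 2 * cosh y`. -/
lemma Represents.integrable_exp_sum_abs {n : ℕ} {μ : Measure (EuclideanSpace ℝ (Fin n))}
    {s : (Fin n → ℕ) → ℝ} (h : Represents μ s) (hs : IsEntire s) (t : Fin n → ℝ) :
    Integrable (fun x => Real.exp (∑ i, |t i * x i|)) μ := by
  have hnn : ∀ (α : Fin n → ℕ) (y : Fin n → ℝ),
      0 ≤ (∏ i, y i ^ (2 * α) i) / (multiFactorial (2 * α) : ℝ) := fun α y =>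
    div_nonneg (Finset.prod_nonneg fun i _ => (even_two_mul (α i)).pow_nonneg _) (by positivity)
  have hcosh : Integrable (fun x : EuclideanSpace ℝ (Fin n) => ∏ i, Real.cosh (t i * x i)) μ := by
    have hcont : Continuous fun x : EuclideanSpace ℝ (Fin n) => ∏ i, Real.cosh (t i * x i) := by
      fun_prop
    refine ⟨hcont.aestronglyMeasurable, ?_⟩
    rw [hasFiniteIntegral_iff_ofReal
      (.of_forall fun x => Finset.prod_nonneg fun i _ => (Real.cosh_pos _).le)]
    have e : ∀ x : EuclideanSpace ℝ (Fin n), ENNReal.ofReal (∏ i, Real.cosh (t i * x i)) =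
        ∑' α : Fin n → ℕ, ENNReal.ofReal
          ((∏ i, (t i * x i) ^ (2 * α) i) / (multiFactorial (2 * α) : ℝ)) := fun x => by
      rw [← ENNReal.ofReal_tsum_of_nonneg (fun α => hnn α _) (hasSum_prod_cosh _).summable,
        (hasSum_prod_cosh _).tsum_eq]
    simp only [e]
    rw [lintegral_tsum fun α => (Continuous.measurable (by fun_prop)).ennreal_ofReal.aemeasurable]
    have hint : ∀ α : Fin n → ℕ, ∫⁻ x : EuclideanSpace ℝ (Fin n), ENNReal.ofReal
        ((∏ i, (t i * x i) ^ (2 * α) i) / (multiFactorial (2 * α) : ℝ)) ∂μ ≤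
        ENNReal.ofReal ‖term s (fun i => (t i : ℂ)) (2 * α)‖ := by
      intro α
      have e2 : ∀ x : EuclideanSpace ℝ (Fin n),
          (∏ i, (t i * x i) ^ (2 * α) i) / (multiFactorial (2 * α) : ℝ) =
          (∏ i, t i ^ (2 * α) i) / (multiFactorial (2 * α) : ℝ) * ∏ i, x i ^ (2 * α) i := by
        intro x
        simp only [mul_pow, Finset.prod_mul_distrib]
        ring
      rw [← ofReal_integral_eq_lintegral_ofReal]
      · refine ENNReal.ofReal_le_ofReal ?_
        simp only [e2]
        rw [integral_const_mul, (h _).2, norm_term]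
        refine (le_abs_self _).trans (le_of_eq ?_)
        rw [abs_mul, abs_div, Finset.abs_prod, Nat.abs_cast]
        simp only [abs_pow, Complex.norm_real, Real.norm_eq_abs]
        ring
      · simp only [e2]
        exact (h _).1.const_mul _
      · exact .of_forall fun x => hnn α _
    refine (ENNReal.tsum_le_tsum hint).trans_lt ?_
    have hinj : Function.Injective fun α : Fin n → ℕ => 2 * α := fun α β hab => by
      ext i
      have := congrFun hab i
      simpa using this
    have hsum := ((hs fun i => (t i : ℂ)).norm.comp_injective hinj)
    exact (hsum.tsum_ofReal_lt_top)
  have hcont : Continuous fun x : EuclideanSpace ℝ (Fin n) => Real.exp (∑ i, |t i * x i|) := by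
    fun_prop
  refine (hcosh.const_mul (2 ^ n)).mono' hcont.aestronglyMeasurable (.of_forall fun x => ?_)
  rw [Real.norm_of_nonneg (Real.exp_pos _).le, Real.exp_sum]
  calc ∏ i, Real.exp |t i * x i| ≤ ∏ i, (2 * Real.cosh (t i * x i)) := by
        refine Finset.prod_le_prod (fun i _ => (Real.exp_pos _).le) fun i _ => ?_
        rw [← Real.cosh_abs, Real.cosh_eq]
        linarith [Real.exp_pos (-|t i * x i|)]
    _ = 2 ^ n * ∏ i, Real.cosh (t i * x i) := by simp [Finset.prod_mul_distrib]

/-- Expand the exponential and integrate termwise; the absolute values of the terms sum to `exp (∑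
|t i * x i|)`. -/
lemma Represents.charFun_eq {n : ℕ} {μ : Measure (EuclideanSpace ℝ (Fin n))}
    {s : (Fin n → ℕ) → ℝ} (h : Represents μ s) (hs : IsEntire s) (t : EuclideanSpace ℝ (Fin n)) :
    charFun μ t = f s (toComplex t) := by
  have hexp := h.integrable_exp_sum_abs hs fun i => t i
  have hsum := hasSum_integral_of_dominated_convergence (μ := μ)
    (F := fun (α : Fin n → ℕ) (x : EuclideanSpace ℝ (Fin n)) =>
      (∏ i, (Complex.I * (t i * x i : ℝ)) ^ α i) / (multiFactorial α : ℂ))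
    (f := fun x => Complex.exp ((inner ℝ x t : ℝ) * Complex.I))
    (fun α x => (∏ i, |t i * x i| ^ α i) / (multiFactorial α : ℝ))
    (fun α => Continuous.aestronglyMeasurable (by fun_prop)) ?_ ?_ ?_ ?_
  · rw [charFun_apply, ← hsum.tsum_eq, f]
    refine tsum_congr fun α => ?_
    have e : ∀ x : EuclideanSpace ℝ (Fin n),
        (∏ i, (Complex.I * (t i * x i : ℝ)) ^ α i) / (multiFactorial α : ℂ) =
        (Complex.I ^ order α * (∏ i, (t i : ℂ) ^ α i) / (multiFactorial α : ℂ)) *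
          ((∏ i, x i ^ α i : ℝ) : ℂ) := by
      intro x
      push_cast
      simp only [mul_pow, Finset.prod_mul_distrib, Finset.prod_pow_eq_pow_sum, order]
      ring
    simp only [e]
    rw [integral_const_mul, integral_complex_ofReal, (h α).2, term]
    simp only [toComplex]
    ring
  · refine fun α => .of_forall fun x => le_of_eq ?_
    simp
  · exact .of_forall fun x => (hasSum_prod_pow_div_factorial _).summable
  · simpa only [(hasSum_prod_pow_div_factorial _).tsum_eq] using hexp
  · refine .of_forall fun x => ?_
    have e : ((inner ℝ x t : ℝ) : ℂ) * Complex.I = ∑ i, Complex.I * (t i * x i : ℝ) := by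
      rw [PiLp.inner_apply, ← Finset.mul_sum]
      simp [mul_comm]
    rw [e]
    exact hasSum_prod_pow_div_factorial_complex _

/-! ### Finite differences recover the coefficients -/

/-- The `a`-th finite difference of `x ↦ x ^ b` at `-m`. -/
noncomputable def powDiff (a : ℕ) (m : ℝ) (b : ℕ) : ℝ :=
  ∑ j ∈ Finset.range (a + 1), ((-1) ^ (a - j) * (a.choose j : ℝ)) * ((j : ℝ) - m) ^ b

lemma powDiff_eq (a : ℕ) (m : ℝ) (b : ℕ) :
    powDiff a m b = (fwdDiff (1 : ℝ))^[a] (fun r : ℝ => r ^ b) (-m) := by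
  rw [fwdDiff_iter_eq_sum_shift, powDiff]
  refine Finset.sum_congr rfl fun j _ => ?_
  rw [zsmul_eq_mul]
  push_cast
  simp only [nsmul_eq_mul, mul_one]
  ring

lemma powDiff_of_lt {a b : ℕ} (m : ℝ) (h : b < a) : powDiff a m b = 0 := by
  rw [powDiff_eq, fwdDiff_iter_pow_eq_zero_of_lt h, Pi.zero_apply]

lemma powDiff_self (a : ℕ) (m : ℝ) : powDiff a m a = a.factorial := by
  rw [powDiff_eq, fwdDiff_iter_eq_factorial, Pi.natCast_apply]

/-- The coefficients of the mixed finite difference of order `α`. -/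
def diffCoeff {n : ℕ} (α j : Fin n → ℕ) : ℝ :=
  ∏ i, ((-1) ^ (α i - j i) * ((α i).choose (j i) : ℝ))

/-- The mixed finite difference of order `α` and step `h` of `F` at `-h m`. -/
noncomputable def mixedDiff {n : ℕ} (F : EuclideanSpace ℝ (Fin n) → ℂ) (α : Fin n → ℕ)
    (m : Fin n → ℝ) (h : ℝ) : ℂ :=
  ∑ j ∈ Fintype.piFinset fun i => Finset.range (α i + 1),
    (diffCoeff α j : ℂ) * F (h • WithLp.toLp 2 fun i => (j i : ℝ) - m i)

/-- The coefficients of the power series in `h` of the mixed finite difference of `f`. -/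
noncomputable def diffSeries {n : ℕ} (s : (Fin n → ℕ) → ℝ) (α : Fin n → ℕ) (m : Fin n → ℝ)
    (β : Fin n → ℕ) : ℂ :=
  Complex.I ^ order β * (s β : ℂ) / (multiFactorial β : ℂ) *
    ((∏ i, powDiff (α i) (m i) (β i) : ℝ) : ℂ)

lemma diffSeries_of_not_le {n : ℕ} (s : (Fin n → ℕ) → ℝ) {α β : Fin n → ℕ} (m : Fin n → ℝ)
    (h : ¬ α ≤ β) : diffSeries s α m β = 0 := by
  simp only [Pi.le_def, not_forall, not_le] at h
  obtain ⟨i, hi⟩ := h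
  rw [diffSeries, Finset.prod_eq_zero (Finset.mem_univ i) (powDiff_of_lt _ hi)]
  simp

lemma diffSeries_self {n : ℕ} (s : (Fin n → ℕ) → ℝ) (α : Fin n → ℕ) (m : Fin n → ℝ) :
    diffSeries s α m α = Complex.I ^ order α * s α := by
  have h : (multiFactorial α : ℂ) ≠ 0 := by
    simp [multiFactorial, Finset.prod_ne_zero_iff, Nat.factorial_ne_zero]
  simp only [diffSeries, powDiff_self]
  rw [← Nat.cast_prod, ← multiFactorial, Complex.ofReal_natCast]
  field_simp

lemma hasSum_mixedDiff {n : ℕ} {s : (Fin n → ℕ) → ℝ} (hs : IsEntire s) (α : Fin n → ℕ)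
    (m : Fin n → ℝ) (h : ℝ) :
    HasSum (fun β => (h : ℂ) ^ order β * diffSeries s α m β)
      (mixedDiff (fun x => f s (toComplex x)) α m h) := by
  have key := hasSum_sum (s := Fintype.piFinset fun i => Finset.range (α i + 1))
    fun j _ => ((hs (toComplex (h • WithLp.toLp 2 fun i => (j i : ℝ) - m i))).hasSum.mul_left
      (diffCoeff α j : ℂ))
  suffices e : ∀ β, (h : ℂ) ^ order β * diffSeries s α m β =
      ∑ j ∈ Fintype.piFinset fun i => Finset.range (α i + 1), (diffCoeff α j : ℂ) *
        term s (toComplex (h • WithLp.toLp 2 fun i => (j i : ℝ) - m i)) β by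
    simp only [e]
    exact key
  intro β
  simp only [diffSeries, powDiff]
  rw [Finset.prod_univ_sum]
  push_cast
  rw [Finset.mul_sum, Finset.mul_sum]
  refine Finset.sum_congr rfl fun j _ => ?_
  simp only [term, toComplex, PiLp.smul_apply, smul_eq_mul, diffCoeff, order]
  push_cast
  simp only [mul_pow, Finset.prod_mul_distrib, Finset.prod_pow_eq_pow_sum]
  ring

lemma order_lt_order {n : ℕ} {α β : Fin n → ℕ} (h : α < β) : order α < order β := by
  obtain ⟨h1, i, hi⟩ := Pi.lt_def.1 h
  exact Finset.sum_lt_sum (fun i _ => h1 i) ⟨i, Finset.mem_univ i, hi⟩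

/-- The difference kills every `β` with `¬ α ≤ β`; after division, `β = α` gives the limit and every
other `β ≥ α` keeps a positive power of `h`. For `0 < h ≤ 1` the series at `h = 1` dominates. -/
lemma tendsto_mixedDiff {n : ℕ} {s : (Fin n → ℕ) → ℝ} (hs : IsEntire s) (α : Fin n → ℕ)
    (m : Fin n → ℝ) :
    Tendsto (fun h : ℝ => mixedDiff (fun x => f s (toComplex x)) α m h / (h : ℂ) ^ order α)
      (𝓝[>] 0) (𝓝 (Complex.I ^ order α * s α)) := by
  have hlim : Tendsto
      (fun h : ℝ => ∑' β, (h : ℂ) ^ (order β - order α) * diffSeries s α m β) (𝓝[>] 0)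
      (𝓝 (∑' β, if β = α then diffSeries s α m β else 0)) := by
    refine tendsto_tsum_of_dominated_convergence (bound := fun β => ‖diffSeries s α m β‖) ?_
      (fun β => ?_) ?_
    · simpa using (hasSum_mixedDiff hs α m 1).summable.norm
    · by_cases hle : α ≤ β
      · have hc : Continuous fun h : ℝ => (h : ℂ) ^ (order β - order α) * diffSeries s α m β := by
          fun_prop
        convert (hc.tendsto 0).mono_left nhdsWithin_le_nhds using 2
        split_ifs with he
        · simp [he]
        · have := order_lt_order (lt_of_le_of_ne hle (Ne.symm he))
          rw [Complex.ofReal_zero, zero_pow (by omega), zero_mul]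
      · simp [diffSeries_of_not_le s m hle]
    · filter_upwards [Ioc_mem_nhdsGT (zero_lt_one' ℝ)] with h hh β
      rw [norm_mul, norm_pow, Complex.norm_real, Real.norm_of_nonneg hh.1.le]
      exact mul_le_of_le_one_left (norm_nonneg _) (pow_le_one₀ hh.1.le hh.2)
  rw [tsum_ite_eq, diffSeries_self] at hlim
  refine hlim.congr' ?_
  filter_upwards [self_mem_nhdsWithin] with h hh
  have hh0 : (h : ℂ) ≠ 0 := Complex.ofReal_ne_zero.2 (ne_of_gt hh)
  rw [← (hasSum_mixedDiff hs α m h).tsum_eq, ← tsum_div_const]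
  refine tsum_congr fun β => ?_
  by_cases hle : α ≤ β
  · have ho : order α ≤ order β := Finset.sum_le_sum fun i _ => hle i
    rw [pow_sub₀ _ hh0 ho]
    ring
  · simp [diffSeries_of_not_le s m hle]

/-- The binomial theorem in each coordinate, under the integral. -/
lemma mixedDiff_charFun {n : ℕ} (μ : Measure (EuclideanSpace ℝ (Fin n))) [IsFiniteMeasure μ]
    (α : Fin n → ℕ) (m : Fin n → ℝ) (h : ℝ) :
    mixedDiff (charFun μ) α m h = ∫ x : EuclideanSpace ℝ (Fin n),
      ∏ i, ((Complex.exp (Complex.I * (h * x i : ℝ)) - 1) ^ α i *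
        Complex.exp (-(Complex.I * (m i * (h * x i) : ℝ)))) ∂μ := by
  simp only [mixedDiff, charFun_apply]
  simp only [← integral_const_mul]
  rw [← integral_finsetSum]
  · refine integral_congr_ae (.of_forall fun x => ?_)
    have e : ∀ i, (Complex.exp (Complex.I * (h * x i : ℝ)) - 1) ^ α i *
        Complex.exp (-(Complex.I * (m i * (h * x i) : ℝ))) =
        ∑ j ∈ Finset.range (α i + 1), (((-1) ^ (α i - j) * ((α i).choose j : ℝ) : ℝ) : ℂ) *
          Complex.exp (Complex.I * (h * ((j : ℝ) - m i) * x i : ℝ)) := by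
      intro i
      rw [sub_eq_add_neg, add_pow, Finset.sum_mul]
      refine Finset.sum_congr rfl fun j _ => ?_
      rw [← Complex.exp_nat_mul, show Complex.I * (h * ((j : ℝ) - m i) * x i : ℝ) =
        j * (Complex.I * (h * x i : ℝ)) + -(Complex.I * (m i * (h * x i) : ℝ)) by
          push_cast; ring, Complex.exp_add]
      push_cast
      ring
    simp only [e]
    rw [Finset.prod_univ_sum]
    refine Finset.sum_congr rfl fun j _ => ?_
    rw [Finset.prod_mul_distrib, ← Complex.exp_sum, diffCoeff, Complex.ofReal_prod]
    congr 2
    rw [PiLp.inner_apply, ← Finset.mul_sum, mul_comm]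
    congr 1
    rw [Complex.ofReal_sum]
    refine Finset.sum_congr rfl fun i _ => ?_
    simp
  · intro j _
    refine Integrable.const_mul ?_ _
    refine Integrable.of_bound (Continuous.aestronglyMeasurable (by fun_prop)) 1
      (.of_forall fun x => ?_)
    rw [Complex.norm_exp_ofReal_mul_I]

lemma order_two_mul {n : ℕ} (α : Fin n → ℕ) : order (2 * α) = 2 * order α := by
  simp [order, Finset.mul_sum]

lemma exp_sub_one_pow_mul_exp (a : ℕ) (y : ℝ) :
    (Complex.exp (Complex.I * y) - 1) ^ (2 * a) * Complex.exp (-(Complex.I * (a * y : ℝ))) =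
      (-1) ^ a * (((2 * Real.sin (y / 2)) ^ (2 * a) : ℝ) : ℂ) := by
  have e : Complex.exp (-(Complex.I * (a * y : ℝ))) = Complex.exp (-(Complex.I * y)) ^ a := by
    rw [← Complex.exp_nat_mul]
    push_cast
    ring_nf
  have hsin : ((2 * Real.sin (y / 2) : ℝ) : ℂ) ^ 2 =
      2 - Complex.exp (Complex.I * y) - Complex.exp (-(Complex.I * y)) := by
    push_cast
    rw [Complex.sin, mul_div_assoc', mul_div_cancel_left₀ _ two_ne_zero, mul_pow, Complex.I_sq,
      sub_sq, ← Complex.exp_nat_mul, ← Complex.exp_nat_mul, mul_assoc, ← Complex.exp_add]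
    rw [show ((2 : ℕ) : ℂ) * (-(y / 2 : ℂ) * Complex.I) = -(Complex.I * y) by push_cast; ring,
      show ((2 : ℕ) : ℂ) * ((y / 2 : ℂ) * Complex.I) = Complex.I * y by push_cast; ring,
      show (-(y / 2 : ℂ) * Complex.I + (y / 2 : ℂ) * Complex.I) = 0 by ring, Complex.exp_zero]
    ring
  rw [e, pow_mul, ← mul_pow, Complex.ofReal_pow, pow_mul, hsin, ← mul_pow]
  congr 1
  have h1 : Complex.exp (Complex.I * y) * Complex.exp (-(Complex.I * y)) = 1 := by
    rw [← Complex.exp_add, add_neg_cancel, Complex.exp_zero]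
  linear_combination (Complex.exp (Complex.I * y) - 2) * h1

/-! ### From the characteristic function to moments -/

section

variable {n : ℕ} {μ : Measure (EuclideanSpace ℝ (Fin n))} [IsFiniteMeasure μ]
  {s : (Fin n → ℕ) → ℝ}

/-- Order `2 * α` with shift `m = α` is a central difference, so up to the sign `(-1) ^ order α` the
integrand is real and nonnegative, as Fatou's lemma will need. -/
lemma tendsto_integral_sin (hs : IsEntire s) (h : charFun μ = fun t => f s (toComplex t))
    (α : Fin n → ℕ) :
    Tendsto (fun h : ℝ => ∫ x : EuclideanSpace ℝ (Fin n),
      ∏ i, (2 * Real.sin (h * x i / 2) / h) ^ (2 * α i) ∂μ) (𝓝[>] 0) (𝓝 (s (2 * α))) := by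
  have h1 := tendsto_mixedDiff hs (2 * α) fun i => (α i : ℝ)
  rw [← h] at h1
  have h2 := Complex.continuous_re.continuousAt.tendsto.comp (h1.const_mul ((-1) ^ order α))
  have e0 : ((-1 : ℂ) ^ order α * (Complex.I ^ order (2 * α) * s (2 * α))).re = s (2 * α) := by
    rw [order_two_mul, pow_mul, Complex.I_sq, ← mul_assoc, ← mul_pow]
    simp
  rw [e0] at h2
  refine h2.congr fun r => ?_
  rw [Function.comp_apply, mixedDiff_charFun, ← integral_div, ← integral_const_mul,
    ← Complex.ofReal_re (∫ x : EuclideanSpace ℝ (Fin n), _ ∂μ), ← integral_complex_ofReal]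
  congr 1
  refine integral_congr_ae (.of_forall fun x => ?_)
  simp only [Pi.mul_apply, Pi.ofNat_apply, exp_sub_one_pow_mul_exp]
  rw [order_two_mul, Finset.prod_mul_distrib, Finset.prod_pow_eq_pow_sum, ← order]
  simp only [div_pow, Finset.prod_div_distrib, Finset.prod_pow_eq_pow_sum, ← Finset.mul_sum]
  rw [← order]
  push_cast
  rw [mul_div_assoc, ← mul_assoc, ← mul_pow]
  simp

/-- Fatou: the sine quotients tend pointwise to `x i`, while their integrals converge to the finite
number `s (2 * α)`. -/
lemma integrable_prod_pow_two_mul (hs : IsEntire s) (h : charFun μ = fun t => f s (toComplex t))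
    (α : Fin n → ℕ) :
    Integrable (fun x : EuclideanSpace ℝ (Fin n) => ∏ i, x i ^ (2 * α i)) μ := by
  have hev : ∀ y : Fin n → ℝ, 0 ≤ ∏ i, y i ^ (2 * α i) := fun y =>
    Finset.prod_nonneg fun i _ => (even_two_mul (α i)).pow_nonneg _
  have hlim : ∀ x : EuclideanSpace ℝ (Fin n), Tendsto (fun h : ℝ => ENNReal.ofReal
      (∏ i, (2 * Real.sin (h * x i / 2) / h) ^ (2 * α i))) (𝓝[>] 0)
      (𝓝 (ENNReal.ofReal (∏ i, x i ^ (2 * α i)))) := by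
    intro x
    refine (ENNReal.continuous_ofReal.tendsto _).comp
      (tendsto_finsetProd _ fun i _ => Tendsto.pow ?_ _)
    have hd : HasDerivAt (fun r : ℝ => 2 * Real.sin (r * x i / 2)) (x i) 0 := by
      have := ((((hasDerivAt_id (0 : ℝ)).mul_const (x i)).div_const 2).sin).const_mul 2
      refine this.congr_deriv ?_
      simp
      ring
    simpa [div_eq_inv_mul] using hd.tendsto_slope_zero_right
  refine ⟨Continuous.aestronglyMeasurable (by fun_prop), ?_⟩
  rw [hasFiniteIntegral_iff_ofReal (.of_forall fun x => hev _)]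
  have hfatou := lintegral_liminf_le (μ := μ) (u := 𝓝[>] (0 : ℝ))
    (f := fun (h : ℝ) (x : EuclideanSpace ℝ (Fin n)) => ENNReal.ofReal
      (∏ i, (2 * Real.sin (h * x i / 2) / h) ^ (2 * α i)))
    fun h => (Continuous.measurable (by fun_prop)).ennreal_ofReal
  simp only [(hlim _).liminf_eq] at hfatou
  refine hfatou.trans_lt ?_
  have hint : ∀ h : ℝ, Integrable (fun x : EuclideanSpace ℝ (Fin n) =>
      ∏ i, (2 * Real.sin (h * x i / 2) / h) ^ (2 * α i)) μ := fun h => by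
    refine Integrable.of_bound (Continuous.aestronglyMeasurable (by fun_prop))
      (∏ i, |2 / h| ^ (2 * α i)) (.of_forall fun x => ?_)
    rw [norm_prod]
    refine Finset.prod_le_prod (fun i _ => norm_nonneg _) fun i _ => ?_
    rw [norm_pow, Real.norm_eq_abs, mul_div_right_comm, abs_mul]
    gcongr
    exact mul_le_of_le_one_right (abs_nonneg _) (Real.abs_sin_le_one _)
  have e : ∀ h : ℝ, ∫⁻ x : EuclideanSpace ℝ (Fin n), ENNReal.ofReal
      (∏ i, (2 * Real.sin (h * x i / 2) / h) ^ (2 * α i)) ∂μ = ENNReal.ofReal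
      (∫ x : EuclideanSpace ℝ (Fin n), ∏ i, (2 * Real.sin (h * x i / 2) / h) ^ (2 * α i) ∂μ) :=
    fun h => (ofReal_integral_eq_lintegral_ofReal (hint h) (.of_forall fun x => hev _)).symm
  simp only [e]
  have hl := ((ENNReal.continuous_ofReal.tendsto _).comp (tendsto_integral_sin hs h α)).liminf_eq
  rw [Function.comp_def] at hl
  rw [hl]
  exact ENNReal.ofReal_lt_top

lemma integrable_prod_abs_pow (hs : IsEntire s) (h : charFun μ = fun t => f s (toComplex t))
    (α : Fin n → ℕ) :
    Integrable (fun x : EuclideanSpace ℝ (Fin n) => ∏ i, |x i| ^ α i) μ := by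
  refine ((integrable_const (1 : ℝ)).add (integrable_prod_pow_two_mul hs h α)).mono'
    (Continuous.aestronglyMeasurable (by fun_prop)) (.of_forall fun x => ?_)
  have e : ∏ i, x i ^ (2 * α i) = (∏ i, |x i| ^ α i) ^ 2 := by
    rw [← Finset.prod_pow]
    refine Finset.prod_congr rfl fun i _ => ?_
    rw [mul_comm, pow_mul, ← abs_pow, sq_abs]
  rw [Real.norm_of_nonneg (Finset.prod_nonneg fun i _ => by positivity), Pi.add_apply, e]
  nlinarith [sq_nonneg (∏ i, |x i| ^ α i - 1)]

/-- If the characteristic function of `μ` is the power series `f`, then `μ` represents `s`. -/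
lemma represents_of_charFun_eq (hs : IsEntire s) (h : charFun μ = fun t => f s (toComplex t)) :
    Represents μ s := by
  intro α
  have habs := integrable_prod_abs_pow hs h α
  refine ⟨habs.mono' (Continuous.aestronglyMeasurable (by fun_prop))
    (.of_forall fun x => by simp), ?_⟩
  have h1 := tendsto_mixedDiff hs α 0
  rw [← h] at h1
  have h2 : Tendsto (fun r : ℝ => mixedDiff (charFun μ) α 0 r / (r : ℂ) ^ order α) (𝓝[>] 0)
      (𝓝 (∫ x : EuclideanSpace ℝ (Fin n), ∏ i, (Complex.I * x i) ^ α i ∂μ)) := by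
    have e : ∀ r : ℝ, mixedDiff (charFun μ) α 0 r / (r : ℂ) ^ order α =
        ∫ x : EuclideanSpace ℝ (Fin n),
          ∏ i, ((Complex.exp (Complex.I * (r * x i : ℝ)) - 1) / r) ^ α i ∂μ := by
      intro r
      rw [mixedDiff_charFun, ← integral_div]
      refine integral_congr_ae (.of_forall fun x => ?_)
      simp [div_pow, Finset.prod_div_distrib, Finset.prod_pow_eq_pow_sum, order]
    simp only [e]
    -- Since `|exp (i r x) - 1| ≤ r |x|`, the absolute monomial dominates.
    refine tendsto_integral_filter_of_dominated_convergence _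
      (.of_forall fun r => Continuous.aestronglyMeasurable (by fun_prop)) ?_ habs
      (.of_forall fun x => ?_)
    · filter_upwards [self_mem_nhdsWithin] with r hr
      refine .of_forall fun x => ?_
      rw [norm_prod]
      refine Finset.prod_le_prod (fun i _ => norm_nonneg _) fun i _ => ?_
      have hr0 : 0 < r := hr
      rw [norm_pow, norm_div, Complex.norm_real, Real.norm_of_nonneg hr0.le]
      refine pow_le_pow_left₀ (by positivity) ?_ _
      rw [div_le_iff₀ hr0]
      refine Real.norm_exp_I_mul_ofReal_sub_one_le.trans ?_
      rw [norm_mul, Real.norm_of_nonneg hr0.le, Real.norm_eq_abs, mul_comm]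
    · refine tendsto_finsetProd _ fun i _ => Tendsto.pow ?_ _
      have hd : HasDerivAt (fun r : ℝ => Complex.exp (Complex.I * (r * x i : ℝ)))
          (Complex.I * x i) 0 := by
        have := ((((hasDerivAt_id (0 : ℝ)).mul_const (x i)).ofReal_comp).const_mul
          Complex.I).cexp
        refine this.congr_deriv ?_
        simp
      simpa [div_eq_inv_mul] using hd.tendsto_slope_zero_right
  have h3 := tendsto_nhds_unique h2 h1
  have e : ∀ x : EuclideanSpace ℝ (Fin n), ∏ i, (Complex.I * x i) ^ α i =
      Complex.I ^ order α * ((∏ i, x i ^ α i : ℝ) : ℂ) := by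
    intro x
    push_cast
    simp only [mul_pow, Finset.prod_mul_distrib, Finset.prod_pow_eq_pow_sum, order]
  simp only [e] at h3
  rw [integral_const_mul, integral_complex_ofReal] at h3
  exact_mod_cast mul_left_cancel₀ (pow_ne_zero _ Complex.I_ne_zero) h3

end

/-! ### Moment sequences and positive definiteness -/

variable {n : ℕ} {s : (Fin n → ℕ) → ℝ}

/-- The quadratic form is the integral of the squared modulus of a trigonometric polynomial. -/
lemma isPosDefFun_charFun {V : Type*} [NormedAddCommGroup V] [InnerProductSpace ℝ V]
    [MeasurableSpace V] [BorelSpace V] [SecondCountableTopology V] (μ : Measure V)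
    [IsFiniteMeasure μ] : IsPosDefFun (charFun μ) := by
  refine isPosDefFun_iff.2 ⟨fun t => charFun_neg t, fun d z c => ?_⟩
  have hint : ∀ j k, Integrable (fun x => star (c j) * Complex.exp
      ((inner ℝ x (z j - z k) : ℝ) * Complex.I) * c k) μ := fun j k => by
    refine (Integrable.const_mul ?_ _).mul_const _
    exact Integrable.of_bound (Continuous.aestronglyMeasurable (by fun_prop)) 1
      (.of_forall fun x => by rw [Complex.norm_exp_ofReal_mul_I])
  have e : ∑ j, ∑ k, star (c j) * charFun μ (z j - z k) * c k =
      ((∫ x, Complex.normSq (∑ j, star (c j) * Complex.exp ((inner ℝ x (z j) : ℝ) * Complex.I)) ∂μ :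
        ℝ) : ℂ) := by
    simp only [charFun_apply, ← integral_const_mul, ← integral_mul_const]
    rw [← integral_complex_ofReal, Finset.sum_congr rfl fun j _ =>
      (integral_finsetSum _ fun k _ => hint j k).symm,
      ← integral_finsetSum _ fun j _ => integrable_finsetSum _ fun k _ => hint j k]
    refine integral_congr_ae (.of_forall fun x => ?_)
    simp only [Complex.normSq_eq_conj_mul_self, map_sum, map_mul, ← Complex.exp_conj,
      Complex.star_def, Complex.conj_conj, Complex.conj_ofReal, Complex.conj_I]
    rw [mul_comm, Finset.sum_mul_sum]
    refine Finset.sum_congr rfl fun j _ => Finset.sum_congr rfl fun k _ => ?_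
    rw [inner_sub_right, Complex.ofReal_sub, sub_mul, sub_eq_add_neg, Complex.exp_add, mul_neg]
    ring
  rw [e]
  exact Complex.zero_le_real.2 (integral_nonneg fun x => Complex.normSq_nonneg _)

lemma f_zero (hs0 : s 0 = 1) : f s (toComplex 0) = 1 := by
  rw [f, tsum_eq_single 0]
  · simp [term, order, multiFactorial, hs0]
  · intro α hα
    obtain ⟨i, hi⟩ := Function.ne_iff.1 hα
    rw [term, Finset.prod_eq_zero (Finset.mem_univ i), mul_zero]
    simpa [toComplex] using hi

lemma isDeterminate_iff_isPosDefFun (hs0 : s 0 = 1) (hs : IsEntire s) :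
    IsDeterminateMomentSequence s ↔ IsPosDefFun fun x => f s (toComplex x) := by
  constructor
  · rintro ⟨μ, hμ, -⟩
    have := hμ.isFiniteMeasure
    have h := isPosDefFun_charFun μ
    rwa [show charFun μ = fun x => f s (toComplex x) from funext (hμ.charFun_eq hs)] at h
  · intro h
    obtain ⟨μ, hμ, hμf⟩ := exists_charFun_eq_of_isPosDefFun h (continuous_f_toComplex hs)
      (f_zero hs0)
    refine ⟨μ, represents_of_charFun_eq hs (funext hμf), fun ν hν => ?_⟩
    have := hν.isFiniteMeasure
    exact Measure.ext_of_charFun (funext fun t => (hν.charFun_eq hs t).trans (hμf t).symm)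

/-! ### Splitting into even and odd parts -/

lemma term_neg (z : Fin n → ℂ) (α : Fin n → ℕ) :
    term s (-z) α = (-1) ^ order α * term s z α := by
  rw [show -z = fun i => ((-1 : ℝ) : ℂ) * z i by ext i; simp, term_real_smul]
  norm_num

lemma f₂_add_f₁ (hs : IsEntire s) (z : Fin n → ℂ) : f₂ s z + f₁ s z = f s z := by
  have h := Summable.tsum_add_tsum_compl (s := {α : Fin n → ℕ | Even (order α)})
    ((hs z).subtype _) ((hs z).subtype _)
  rw [show {α : Fin n → ℕ | Even (order α)}ᶜ = {α | Odd (order α)} by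
    ext α
    simp] at h
  exact h

lemma f₁_neg (z : Fin n → ℂ) : f₁ s (-z) = -f₁ s z := by
  rw [f₁, f₁, ← tsum_neg]
  refine tsum_congr fun α => ?_
  rw [term_neg, α.2.neg_one_pow, neg_one_mul]

lemma f₂_neg (z : Fin n → ℂ) : f₂ s (-z) = f₂ s z := by
  refine tsum_congr fun α => ?_
  rw [term_neg, α.2.neg_one_pow, one_mul]

lemma differenceMatrix_neg {d : ℕ} (g : (Fin n → ℂ) → ℂ)
    (z : Fin d → EuclideanSpace ℝ (Fin n)) :
    differenceMatrix g (-z) = differenceMatrix (fun w => g (-w)) z := by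
  ext j k
  simp only [differenceMatrix, Matrix.of_apply, Pi.neg_apply]
  congr 1
  ext i
  simp [toComplex]
  ring

lemma differenceMatrix_f (hs : IsEntire s) {d : ℕ} (z : Fin d → EuclideanSpace ℝ (Fin n)) :
    differenceMatrix (f s) z = differenceMatrix (f₂ s) z + differenceMatrix (f₁ s) z := by
  ext j k
  simp [differenceMatrix, f₂_add_f₁ hs]

lemma differenceMatrix_f_neg (hs : IsEntire s) {d : ℕ} (z : Fin d → EuclideanSpace ℝ (Fin n)) :
    differenceMatrix (f s) (-z) = differenceMatrix (f₂ s) z - differenceMatrix (f₁ s) z := by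
  rw [differenceMatrix_neg]
  ext j k
  simp [differenceMatrix, ← f₂_add_f₁ hs, f₁_neg, f₂_neg, sub_eq_add_neg]

end BochnerTest

theorem theorem4p9 (n : ℕ) (s : (Fin n → ℕ) → ℝ) (hs0 : s 0 = 1)
    (hf : BochnerTest.IsEntire s) :
    List.TFAE [
      BochnerTest.IsDeterminateMomentSequence s,
      ∀ (d : ℕ) (z : Fin d → EuclideanSpace ℝ (Fin n)),
        (BochnerTest.differenceMatrix (BochnerTest.f s) z).PosSemidef,
      ∀ (d : ℕ) (z : Fin d → EuclideanSpace ℝ (Fin n)),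
        (BochnerTest.differenceMatrix (BochnerTest.f₂ s) z).PosSemidef ∧
        (BochnerTest.differenceMatrix (BochnerTest.f₂ s) z -
          BochnerTest.differenceMatrix (BochnerTest.f₁ s) z).PosSemidef] := by
  -- Condition (ii) unfolds definitionally to `IsPosDefFun`.
  tfae_have 1 ↔ 2 := BochnerTest.isDeterminate_iff_isPosDefFun hs0 hf
  tfae_have 2 → 3 := by
    intro h d z
    have h1 := h d z
    have h2 := h d (-z)
    rw [BochnerTest.differenceMatrix_f_neg hf] at h2
    refine ⟨?_, h2⟩
    rw [BochnerTest.differenceMatrix_f hf] at h1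
    -- The matrix of `f₂` is the mean of those of `f` at `z` and at `-z`.
    have h3 := (h1.add h2).smul (show (0 : ℝ) ≤ 1 / 2 by norm_num)
    convert h3 using 1
    module
  tfae_have 3 → 2 := by
    intro h d z
    have h1 := (h d (-z)).2
    rw [← BochnerTest.differenceMatrix_f_neg hf, neg_neg] at h1
    exact h1
  tfae_finish
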